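/- Let $H$ and $K$ be complex Hilbert spaces, with inner products linear in the first argument. A conjugation on $K$ is an antilinear map $C:K\to K$ with $C^2=I$ and $\langle Cx,Cy\rangle=\langle y,x\rangle$ for all $x,y\in K$. A (linear or antilinear) operator $A$ from $H$ to $K$ is a linear or antilinear map $A:D(A)\to K$ on a linear subspace $D(A)\subseteq H$; it is densely defined if $D(A)$ is dense in $H$, and closed if its graph $\{(x,Ax):x\in D(A)\}$ is closed in $H\times K$; $R(A)=\{Ax:x\in D(A)\}$ is its range. For a densely defined antilinear operator $T$ from $H$ to $K$, its adjoint $T^\sharp$ is the antilinear operator from $K$ to $H$ whose domain $D(T^\sharp)$ is the set of all $y\in K$ for which there is $u\in H$ with $\overline{\langle Tx,y\rangle}=\langle x,u\rangle$ for all $x\in D(T)$, and $T^\sharp y=u$ (which is unique). A product $BA$ of operators has the domain $\{x\in D(A):Ax\in D(B)\}$. (a) Let $S$ be a densely defined closed linear operator from $H$ to $K$ and let $C$ be a conjugation on $K$. Then the following statements are equivalent: (1) $R((CS)^\sharp)$ is closed in $H$; (2) $R((CS)^\sharp(CS))=R((CS)^\sharp)$; (3) $R((CS)^\sharp(CS))$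 is closed in $H$; (4) $R(CS)$ is closed in $K$. (b) Let $T$ be a densely defined closed antilinear operator from $H$ to $K$. Then $R(T)$ is closed in $K$ if and only if $R(T^\sharp)$ is closed in $H$. -/

import Mathlib

open scoped ComplexConjugate InnerProductSpace

noncomputable section

/-- A conjugation on a complex inner product space `K`: an antilinear map `C : K → K` with
`C² = I` that is isometric in the sense that `⟨Cx, Cy⟩ = ⟨y, x⟩`. -/
structure IsConjugation {K : Type*} [NormedAddCommGroup K] [InnerProductSpace ℂ K]
    (C : K →ₛₗ[starRingEnd ℂ] K) : Prop where
  involutive : ∀ x, C (C x) = x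
  inner_map_map : ∀ x y, ⟪C x, C y⟫_ℂ = ⟪y, x⟫_ℂ

namespace LinearPMap

/-- The product `g f` of two partially defined semilinear operators, on its natural domain
`{x ∈ D(f) : f x ∈ D(g)}`. -/
def prodOp {R S T : Type*} [Ring R] [Ring S] [Ring T] {σ : R →+* S} {τ : S →+* T} {ρ : R →+* T}
    [RingHomCompTriple σ τ ρ] {E F G : Type*} [AddCommGroup E] [Module R E]
    [AddCommGroup F] [Module S F] [AddCommGroup G] [Module T G]
    (g : F →ₛₗ.[τ] G) (f : E →ₛₗ.[σ] F) : E →ₛₗ.[ρ] G where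
  domain :=
    { carrier := {x | ∃ hx : x ∈ f.domain, f ⟨x, hx⟩ ∈ g.domain}
      zero_mem' := ⟨f.domain.zero_mem, by
        have h : f ⟨0, f.domain.zero_mem⟩ = 0 := f.map_zero
        rw [h]; exact g.domain.zero_mem⟩
      add_mem' := by
        rintro x y ⟨hx, hx'⟩ ⟨hy, hy'⟩
        refine ⟨f.domain.add_mem hx hy, ?_⟩
        have h := f.map_add ⟨x, hx⟩ ⟨y, hy⟩
        exact h ▸ g.domain.add_mem hx' hy'
      smul_mem' := by
        rintro c x ⟨hx, hx'⟩
        refine ⟨f.domain.smul_mem c hx, ?_⟩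
        have h := f.map_smulₛₗ c ⟨x, hx⟩
        exact h ▸ g.domain.smul_mem (σ c) hx' }
  toFun :=
    { toFun := fun x => g ⟨f ⟨x.1, x.2.1⟩, x.2.2⟩
      map_add' := by
        rintro ⟨x, hx, hx'⟩ ⟨y, hy, hy'⟩
        rw [← g.map_add]
        congr 1
        exact Subtype.ext (f.map_add ⟨x, hx⟩ ⟨y, hy⟩)
      map_smul' := by
        rintro c ⟨x, hx, hx'⟩
        rw [← RingHomCompTriple.comp_apply (σ₁₂ := σ) (σ₂₃ := τ) (σ₁₃ := ρ), ← g.map_smulₛₗ]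
        congr 1
        exact Subtype.ext (f.map_smulₛₗ c ⟨x, hx⟩) }

/-- A partially defined antilinear operator is closed if its graph is closed in `H × K`. -/
def IsClosedAntilinear {H K : Type*} [NormedAddCommGroup H] [InnerProductSpace ℂ H]
    [NormedAddCommGroup K] [InnerProductSpace ℂ K] (T : H →ₛₗ.[starRingEnd ℂ] K) : Prop :=
  _root_.IsClosed {p : H × K | ∃ x : T.domain, (x : H) = p.1 ∧ T x = p.2}

section Sharp

variable {H K : Type*} [NormedAddCommGroup H] [InnerProductSpace ℂ H]
  [NormedAddCommGroup K] [InnerProductSpace ℂ K] (T : H →ₛₗ.[starRingEnd ℂ] K)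

/-- The domain of the adjoint `T♯` of an antilinear operator: all `y` for which there is `u` such
that the conjugate of `⟨Tx, y⟩` equals `⟨x, u⟩` for all `x ∈ D(T)`, where `⟨·, ·⟩` is linear in its
first argument. As Mathlib's inner product is linear in the second argument, this reads
`⟪T x, y⟫_ℂ = ⟪u, x⟫_ℂ`. -/
def sharpDomain : Submodule ℂ K where
  carrier := {y | ∃ u : H, ∀ x : T.domain, ⟪T x, y⟫_ℂ = ⟪u, (x : H)⟫_ℂ}
  zero_mem' := ⟨0, by simp⟩
  add_mem' := by
    rintro y z ⟨u, hu⟩ ⟨v, hv⟩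
    exact ⟨u + v, fun x => by rw [inner_add_right, inner_add_left, hu, hv]⟩
  smul_mem' := by
    rintro c y ⟨u, hu⟩
    exact ⟨conj c • u, fun x => by
      rw [inner_smul_right, inner_smul_left, hu, Complex.conj_conj]⟩

variable {T} in
/-- The vector `u` in the definition of the adjoint is unique if `D(T)` is dense. -/
theorem sharp_unique (hT : Dense (T.domain : Set H)) {y : K} {u v : H}
    (hu : ∀ x : T.domain, ⟪T x, y⟫_ℂ = ⟪u, (x : H)⟫_ℂ)
    (hv : ∀ x : T.domain, ⟪T x, y⟫_ℂ = ⟪v, (x : H)⟫_ℂ) : u = v :=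
  hT.eq_of_inner_left ℂ fun x hx => (hu ⟨x, hx⟩).symm.trans (hv ⟨x, hx⟩)

/-- The adjoint `T♯` of a densely defined antilinear operator `T`: `T♯ y` is the unique `u` such
that the conjugate of `⟨Tx, y⟩` equals `⟨x, u⟩` for all `x ∈ D(T)`. -/
def sharp (hT : Dense (T.domain : Set H)) : K →ₛₗ.[starRingEnd ℂ] H where
  domain := T.sharpDomain
  toFun :=
    { toFun := fun y => Classical.choose y.2
      map_add' := fun y z => by
        refine sharp_unique hT (Classical.choose_spec (y + z).2) fun x => ?_
        rw [Submodule.coe_add, inner_add_right, inner_add_left, Classical.choose_spec y.2 x,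
          Classical.choose_spec z.2 x]
      map_smul' := fun c y => by
        refine sharp_unique hT (Classical.choose_spec (c • y).2) fun x => ?_
        rw [Submodule.coe_smul, inner_smul_right, inner_smul_left, Classical.choose_spec y.2 x,
          Complex.conj_conj] }

theorem inner_sharp (hT : Dense (T.domain : Set H)) (y : (T.sharp hT).domain) (x : T.domain) :
    ⟪T x, (y : K)⟫_ℂ = ⟪T.sharp hT y, (x : H)⟫_ℂ :=
  Classical.choose_spec y.2 x

end Sharp

end LinearPMap

/-- The antilinear operator `C S`, for an everywhere defined antilinear `C` and a partially defined
linear operator `S`; its domain is `D(S)`. -/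
def conjComp {H K : Type*} [NormedAddCommGroup H] [InnerProductSpace ℂ H]
    [NormedAddCommGroup K] [InnerProductSpace ℂ K]
    (C : K →ₛₗ[starRingEnd ℂ] K) (S : H →ₗ.[ℂ] K) : H →ₛₗ.[starRingEnd ℂ] K :=
  C.compPMap S

theorem dense_domain_conjComp {H K : Type*} [NormedAddCommGroup H] [InnerProductSpace ℂ H]
    [NormedAddCommGroup K] [InnerProductSpace ℂ K]
    (C : K →ₛₗ[starRingEnd ℂ] K) {S : H →ₗ.[ℂ] K} (hS : Dense (S.domain : Set H)) :
    Dense ((conjComp C S).domain : Set H) :=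
  hS

end

/-!
Closedness of the ranges of an antilinear operator `T`, of its adjoint `T♯`, and of `T♯ T`.

The argument rests on the orthogonal decomposition of `H × K` into the graph of a closed `T` and
`{(-T♯ z, z)}` (`LinearPMap.exists_add_sharp_decomposition`). The graph of an antilinear operator is
only a real subspace, so the projection is taken in the real Hilbert space `H × K`; the
complex adjoint relation comes back by testing with `I • x`. From the decomposition one reads off
that `T♯` is densely defined, that `T♯♯ = T`, and that `I + T♯ T` is onto.

* If `R(T)` is closed, the open mapping theorem on the graph gives preimages of controlled norm, so
  for `u` orthogonal to `N(T)` the functional `T x ↦ ⟪x, u⟫` is bounded, and a representing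
  vector is a preimage of `u` under `T♯`. Hence `R(T♯) = N(T)ᗮ` is closed. With `T♯♯ = T` this is
  the closed range theorem `LinearPMap.isClosed_range_iff_sharp`.
* If `R(T)` is closed, projecting onto it shows `R(T♯ T) = R(T♯)`. Conversely this equality says
  `D(T♯) ⊆ R(T) + N(T♯)`, and uniform boundedness on the graph of `T♯` makes `T♯` bounded below on
  `N(T♯)ᗮ` (`LinearPMap.exists_sharp_bound_of_range_eq`), so that `R(T) = R(T♯♯)` is closed.
* Surjectivity of `I + T♯ T` gives `R(T♯ T)ᗮ ⊆ N(T)`, so `R(T♯ T)` is dense in `R(T♯)`; if it is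
  closed the two agree (`LinearPMap.range_prodOp_sharp_eq_of_isClosed`).

The statements about `C S` are the case `T = C S`, which is closed because `C` is a continuous
involution.
-/

noncomputable section

namespace LinearPMap

variable {H K : Type*} [NormedAddCommGroup H] [InnerProductSpace ℂ H]
  [NormedAddCommGroup K] [InnerProductSpace ℂ K] {T : H →ₛₗ.[starRingEnd ℂ] K}

/-! ### Hilbert space preliminaries -/

/-- Orthogonal projection onto a closed subspace of `E × F` for the Hilbert sum inner product. The
product carries the sup norm, so the projection is taken in `WithLp 2 (E × F)`, which has the same
closed subspaces. -/
theorem exists_mem_forall_inner_add_inner_eq_zero {E F : Type*}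
    [NormedAddCommGroup E] [InnerProductSpace ℝ E] [CompleteSpace E]
    [NormedAddCommGroup F] [InnerProductSpace ℝ F] [CompleteSpace F]
    (V : Submodule ℝ (E × F)) (hV : _root_.IsClosed (V : Set (E × F))) (p : E × F) :
    ∃ g ∈ V, ∀ q ∈ V, ⟪p.1 - g.1, q.1⟫_ℝ + ⟪p.2 - g.2, q.2⟫_ℝ = 0 := by
  let e := WithLp.prodContinuousLinearEquiv 2 ℝ E F
  let G : Submodule ℝ (WithLp 2 (E × F)) := V.comap (e : WithLp 2 (E × F) →ₗ[ℝ] E × F)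
  have hG : _root_.IsClosed (G : Set (WithLp 2 (E × F))) := hV.preimage e.continuous
  have : CompleteSpace G := hG.isComplete.completeSpace_coe
  refine ⟨e (G.starProjection (e.symm p)), G.starProjection_apply_mem (e.symm p), fun q hq => ?_⟩
  have h := G.starProjection_inner_eq_zero (e.symm p) (e.symm q) hq
  rwa [WithLp.prod_inner_apply] at h

theorem eq_zero_of_inner_self_add_inner_self {x : H} {z : K} (h : ⟪x, x⟫_ℂ + ⟪z, z⟫_ℂ = 0) :
    x = 0 ∧ z = 0 := by
  have h' := congrArg Complex.re h
  have hx := inner_self_eq_norm_sq (𝕜 := ℂ) x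
  have hz := inner_self_eq_norm_sq (𝕜 := ℂ) z
  simp only [RCLike.re_to_complex] at hx hz
  rw [Complex.add_re, hx, hz, Complex.zero_re] at h'
  constructor <;> refine norm_eq_zero.1 ?_ <;> nlinarith [sq_nonneg ‖x‖, sq_nonneg ‖z‖]

/-! ### The graph of an antilinear operator and the adjoint relation -/

variable (T) in
/-- The graph of an antilinear operator. It is a subspace over `ℝ` only, since `T (I • x)` is
`-I • T x`. -/
def realGraph : Submodule ℝ (H × K) where
  carrier := {p | ∃ x : T.domain, (x : H) = p.1 ∧ T x = p.2}
  zero_mem' := ⟨0, rfl, T.map_zero⟩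
  add_mem' := by
    rintro _ _ ⟨x, hx, hx'⟩ ⟨y, hy, hy'⟩
    exact ⟨x + y, by simp [hx, hy], by simp [T.map_add, hx', hy']⟩
  smul_mem' := by
    rintro c _ ⟨x, hx, hx'⟩
    refine ⟨(c : ℂ) • x, by simp [hx], ?_⟩
    rw [T.map_smulₛₗ, hx', Complex.conj_ofReal, Complex.coe_smul, Prod.smul_snd]

theorem IsClosedAntilinear.isClosed_realGraph (hc : T.IsClosedAntilinear) :
    _root_.IsClosed (T.realGraph : Set (H × K)) := hc

variable (T) in
/-- The relation `T♯ y = u`, which makes sense without density of the domain of `T`. -/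
def IsSharpPair (y : K) (u : H) : Prop := ∀ x : T.domain, ⟪T x, y⟫_ℂ = ⟪u, (x : H)⟫_ℂ

theorem IsSharpPair.sub {y z : K} {u v : H} (h : T.IsSharpPair y u) (h' : T.IsSharpPair z v) :
    T.IsSharpPair (y - z) (u - v) := fun x => by
  rw [inner_sub_right, inner_sub_left, h x, h' x]

theorem isSharpPair_sharp (hT : Dense (T.domain : Set H)) (y : (T.sharp hT).domain) :
    T.IsSharpPair y (T.sharp hT y) := T.inner_sharp hT y

theorem IsSharpPair.exists_sharp_eq (hT : Dense (T.domain : Set H)) {y : K} {u : H}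
    (h : T.IsSharpPair y u) : ∃ y' : (T.sharp hT).domain, (y' : K) = y ∧ T.sharp hT y' = u :=
  ⟨⟨y, u, h⟩, rfl, sharp_unique hT (T.inner_sharp hT ⟨y, u, h⟩) h⟩

theorem mem_range_sharp (hT : Dense (T.domain : Set H)) {u : H} :
    u ∈ Set.range (T.sharp hT) ↔ ∃ y, T.IsSharpPair y u := by
  constructor
  · rintro ⟨y, rfl⟩
    exact ⟨y, isSharpPair_sharp hT y⟩
  · rintro ⟨y, h⟩
    obtain ⟨y', -, h'⟩ := h.exists_sharp_eq hT
    exact ⟨y', h'⟩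

theorem mem_range_prodOp_sharp (hT : Dense (T.domain : Set H)) {u : H} :
    u ∈ Set.range (prodOp (ρ := RingHom.id ℂ) (T.sharp hT) T) ↔
      ∃ x : T.domain, T.IsSharpPair (T x) u := by
  constructor
  · rintro ⟨⟨x, hx, hx'⟩, rfl⟩
    exact ⟨⟨x, hx⟩, isSharpPair_sharp hT ⟨T ⟨x, hx⟩, hx'⟩⟩
  · rintro ⟨⟨x, hx⟩, h⟩
    exact ⟨⟨x, hx, u, h⟩, sharp_unique hT (T.inner_sharp hT ⟨T ⟨x, hx⟩, u, h⟩) h⟩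

theorem range_prodOp_sharp_subset (hT : Dense (T.domain : Set H)) :
    Set.range (prodOp (ρ := RingHom.id ℂ) (T.sharp hT) T) ⊆ Set.range (T.sharp hT) := fun _ hu =>
  have ⟨x, h⟩ := (mem_range_prodOp_sharp hT).1 hu
  (mem_range_sharp hT).2 ⟨T x, h⟩

theorem isClosedAntilinear_sharp (hT : Dense (T.domain : Set H)) :
    (T.sharp hT).IsClosedAntilinear := by
  have h : {p : K × H | ∃ y : (T.sharp hT).domain, (y : K) = p.1 ∧ T.sharp hT y = p.2} =
      ⋂ x : T.domain, {p : K × H | ⟪T x, p.1⟫_ℂ = ⟪p.2, (x : H)⟫_ℂ} := by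
    ext ⟨y, u⟩
    simp only [Set.mem_ofPred_eq, Set.mem_iInter]
    constructor
    · rintro ⟨y, rfl, rfl⟩
      exact T.inner_sharp hT y
    · exact fun h => IsSharpPair.exists_sharp_eq hT h
  rw [IsClosedAntilinear, h]
  exact isClosed_iInter fun x => isClosed_eq (by fun_prop) (by fun_prop)

/-! ### The orthogonal decomposition along the graph, and its consequences -/

/-- For closed `T`, the product `H × K` is the orthogonal sum of the graph of `T` and of
`{(-T♯ z, z)}`. -/
theorem exists_add_sharp_decomposition [CompleteSpace H] [CompleteSpace K]
    (hc : T.IsClosedAntilinear) (a : H) (b : K) :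
    ∃ (x : T.domain) (z : K) (u : H), T.IsSharpPair z u ∧ a = x - u ∧ b = T x + z := by
  let : InnerProductSpace ℝ H := InnerProductSpace.rclikeToReal ℂ H
  let : InnerProductSpace ℝ K := InnerProductSpace.rclikeToReal ℂ K
  obtain ⟨⟨_, _⟩, ⟨x, rfl, rfl⟩, hx⟩ :=
    exists_mem_forall_inner_add_inner_eq_zero T.realGraph hc.isClosed_realGraph (a, b)
  refine ⟨x, b - T x, x - a, fun w => ?_, by simp, by simp⟩
  -- Orthogonality of the residual to the graph, over `ℝ`.
  have key : ∀ w : T.domain, (⟪T w, b - T x⟫_ℂ).re = (⟪(x : H) - a, (w : H)⟫_ℂ).re := fun w => by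
    have h3 : (⟪a - x, (w : H)⟫_ℂ).re + (⟪b - T x, T w⟫_ℂ).re = 0 :=
      hx (w, T w) ⟨w, rfl, rfl⟩
    have h4 := inner_re_symm (𝕜 := ℂ) (b - T x) (T w)
    simp only [RCLike.re_to_complex] at h4
    rw [← h4, ← neg_sub a, inner_neg_left, Complex.neg_re]
    linarith
  -- Testing with `I • w` gives the imaginary parts.
  apply Complex.ext (key w)
  have h := key (Complex.I • w)
  rw [T.map_smulₛₗ, inner_smul_left, Complex.conj_conj, Submodule.coe_smul, inner_smul_right,
    Complex.I_mul_re, Complex.I_mul_re] at h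
  exact neg_injective h

theorem dense_sharp_domain [CompleteSpace H] [CompleteSpace K] (hT : Dense (T.domain : Set H))
    (hc : T.IsClosedAntilinear) : Dense ((T.sharp hT).domain : Set K) := by
  rw [Submodule.dense_iff_topologicalClosure_eq_top, Submodule.topologicalClosure_eq_top_iff,
    Submodule.eq_bot_iff]
  intro y hy
  obtain ⟨x, z, u, hzu, hx, hz⟩ := exists_add_sharp_decomposition hc 0 y
  obtain rfl : (x : H) = u := (sub_eq_zero.1 hx.symm)
  have h : ⟪y, z⟫_ℂ = 0 := (Submodule.mem_orthogonal' _ _).1 hy z ⟨x, hzu⟩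
  rw [hz, inner_add_left, hzu x] at h
  obtain ⟨hx0, hz0⟩ := eq_zero_of_inner_self_add_inner_self h
  obtain rfl : x = 0 := Subtype.ext hx0
  rw [hz, hz0, T.map_zero, add_zero]

/-- `T♯♯ ⊆ T` for closed `T`. -/
theorem exists_eq_of_isSharpPair_sharp [CompleteSpace H] [CompleteSpace K]
    (hT : Dense (T.domain : Set H)) (hc : T.IsClosedAntilinear) {a : H} {b : K}
    (h : (T.sharp hT).IsSharpPair a b) : ∃ x : T.domain, (x : H) = a ∧ T x = b := by
  obtain ⟨x, z, u, hzu, rfl, rfl⟩ := exists_add_sharp_decomposition hc a b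
  obtain ⟨z, rfl, rfl⟩ := hzu.exists_sharp_eq hT
  have h1 := h z
  rw [inner_sub_right, inner_add_left, T.inner_sharp hT z x] at h1
  obtain ⟨hz0, hu0⟩ := eq_zero_of_inner_self_add_inner_self
    (show ⟪(z : K), (z : K)⟫_ℂ + ⟪T.sharp hT z, T.sharp hT z⟫_ℂ = 0 by linear_combination -h1)
  exact ⟨x, by rw [hu0, sub_zero], by rw [hz0, add_zero]⟩

/-! ### Closed range and the adjoint -/

/-- If `T` has preimages of controlled norm, then every vector orthogonal to the kernel of `T`
lies in the range of `T♯`: the functional `T x ↦ ⟪x, u⟫` is well defined and bounded, and a vector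
representing an extension of it is a preimage of `u`. -/
theorem exists_isSharpPair_of_bound [CompleteSpace K] {M : ℝ}
    (hM : ∀ x : T.domain, ∃ x' : T.domain, T x' = T x ∧ ‖(x' : H)‖ ≤ M * ‖T x‖) {u : H}
    (hu : ∀ x : T.domain, T x = 0 → ⟪u, (x : H)⟫_ℂ = 0) : ∃ y, T.IsSharpPair y u := by
  have hu' : ∀ x x' : T.domain, T x = T x' → ⟪(x : H), u⟫_ℂ = ⟪(x' : H), u⟫_ℂ := fun x x' h => by
    rw [← sub_eq_zero, ← inner_sub_left, inner_eq_zero_symm]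
    exact hu (x - x') (by rw [T.map_sub, h, sub_self])
  let R : Submodule ℂ K := LinearMap.range T.toFun
  have hR : ∀ r : R, ∃ x : T.domain, T x = r ∧ ‖(x : H)‖ ≤ M * ‖r‖ := by
    rintro ⟨_, x, rfl⟩
    exact hM x
  choose g hg hgM using hR
  let φ : R →ₗ[ℂ] ℂ :=
    { toFun := fun r => ⟪(g r : H), u⟫_ℂ
      map_add' := fun r s => by
        rw [← inner_add_left]
        exact hu' _ (g r + g s) (by simp [T.map_add, hg])
      map_smul' := fun c r => by
        have := hu' (g (c • r)) (conj c • g r) (by simp [T.map_smulₛₗ, hg])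
        rw [this, Submodule.coe_smul, inner_smul_left, Complex.conj_conj]
        rfl }
  let ψ : StrongDual ℂ R := φ.mkContinuous (M * ‖u‖) fun r =>
    (norm_inner_le_norm _ _).trans <| by
      nlinarith [mul_le_mul_of_nonneg_right (hgM r) (norm_nonneg u)]
  obtain ⟨f, hf, -⟩ := exists_extension_norm_eq R ψ
  refine ⟨(InnerProductSpace.toDual ℂ K).symm f, fun x => ?_⟩
  rw [← inner_conj_symm, InnerProductSpace.toDual_symm_apply, ← inner_conj_symm u]
  congr 1
  exact (hf ⟨T x, x, rfl⟩).trans (hu' _ _ (hg _))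

/-- The open mapping theorem on the graph. -/
theorem exists_bound_of_isClosed_range [CompleteSpace H] [CompleteSpace K]
    (hc : T.IsClosedAntilinear) (hR : _root_.IsClosed (Set.range T)) :
    ∃ M, ∀ x : T.domain, ∃ x' : T.domain, T x' = T x ∧ ‖(x' : H)‖ ≤ M * ‖T x‖ := by
  let R : Submodule ℝ K := (LinearMap.range T.toFun).restrictScalars ℝ
  have : CompleteSpace R := (_root_.IsClosed.isComplete (s := (R : Set K)) hR).completeSpace_coe
  have : CompleteSpace T.realGraph := (_root_.IsClosed.isComplete hc.isClosed_realGraph).completeSpace_coe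
  let f : T.realGraph →L[ℝ] R :=
    ((ContinuousLinearMap.snd ℝ H K).comp T.realGraph.subtypeL).codRestrict R
      fun ⟨_, x, _, hx⟩ => ⟨x, hx⟩
  have hf : Function.Surjective f := by
    rintro ⟨_, x, rfl⟩
    exact ⟨⟨(x, T x), x, rfl, rfl⟩, rfl⟩
  obtain ⟨M, -, hM⟩ := f.exists_preimage_norm_le hf
  refine ⟨M, fun x => ?_⟩
  obtain ⟨⟨⟨a, b⟩, x', hx', hb⟩, hfx, hn⟩ := hM ⟨T x, x, rfl⟩
  have hb' : b = T x := congrArg Subtype.val hfx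
  refine ⟨x', hb.trans hb', ?_⟩
  rw [hx']
  exact (norm_fst_le (a, b)).trans hn

/-- If `T` has preimages of controlled norm, then the range of `T♯` is the orthogonal complement
of the kernel of `T`. -/
theorem isClosed_range_sharp_of_bound [CompleteSpace K]
    (hT : Dense (T.domain : Set H)) {M : ℝ}
    (hM : ∀ x : T.domain, ∃ x' : T.domain, T x' = T x ∧ ‖(x' : H)‖ ≤ M * ‖T x‖) :
    _root_.IsClosed (Set.range (T.sharp hT)) := by
  have h : Set.range (T.sharp hT) =
      ⋂ x : {x : T.domain // T x = 0}, {u : H | ⟪u, (x : H)⟫_ℂ = 0} := by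
    ext u
    simp only [Set.mem_iInter, Set.mem_ofPred_eq, mem_range_sharp]
    constructor
    · rintro ⟨y, h⟩ ⟨x, hx⟩
      rw [← h x, hx, inner_zero_left]
    · exact fun h => exists_isSharpPair_of_bound hM fun x hx => h ⟨x, hx⟩
  rw [h]
  exact isClosed_iInter fun x => isClosed_eq (by fun_prop) continuous_const

theorem range_sharp_sharp [CompleteSpace H] [CompleteSpace K] (hT : Dense (T.domain : Set H))
    (hc : T.IsClosedAntilinear) :
    Set.range ((T.sharp hT).sharp (dense_sharp_domain hT hc)) = Set.range T := by
  ext b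
  rw [mem_range_sharp]
  constructor
  · rintro ⟨a, h⟩
    obtain ⟨x, -, hx⟩ := exists_eq_of_isSharpPair_sharp hT hc h
    exact ⟨x, hx⟩
  · rintro ⟨x, rfl⟩
    refine ⟨x, fun y => ?_⟩
    rw [T.inner_sharp hT y x]

theorem isClosed_range_of_sharp_bound [CompleteSpace H] [CompleteSpace K]
    (hT : Dense (T.domain : Set H)) (hc : T.IsClosedAntilinear) {M : ℝ}
    (hM : ∀ y : (T.sharp hT).domain, ∃ y' : (T.sharp hT).domain,
      T.sharp hT y' = T.sharp hT y ∧ ‖(y' : K)‖ ≤ M * ‖T.sharp hT y‖) :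
    _root_.IsClosed (Set.range T) := by
  rw [← range_sharp_sharp hT hc]
  exact isClosed_range_sharp_of_bound _ hM

/-- The closed range theorem for antilinear operators. -/
theorem isClosed_range_iff_sharp [CompleteSpace H] [CompleteSpace K]
    (hT : Dense (T.domain : Set H)) (hc : T.IsClosedAntilinear) :
    _root_.IsClosed (Set.range T) ↔ _root_.IsClosed (Set.range (T.sharp hT)) := by
  constructor
  · intro hR
    obtain ⟨M, hM⟩ := exists_bound_of_isClosed_range hc hR
    exact isClosed_range_sharp_of_bound hT hM
  · intro hR
    obtain ⟨M, hM⟩ := exists_bound_of_isClosed_range (isClosedAntilinear_sharp hT) hR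
    exact isClosed_range_of_sharp_bound hT hc hM

/-! ### The range of `T♯ T` -/

/-- Along `K = R(T) ⊕ R(T)ᗮ`, the operator `T♯` only sees the component in `R(T)`. -/
theorem range_prodOp_sharp_eq_of_isClosed_range [CompleteSpace K]
    (hT : Dense (T.domain : Set H)) (hR : _root_.IsClosed (Set.range T)) :
    Set.range (prodOp (ρ := RingHom.id ℂ) (T.sharp hT) T) = Set.range (T.sharp hT) := by
  refine (range_prodOp_sharp_subset hT).antisymm fun u hu => ?_
  obtain ⟨y, h⟩ := (mem_range_sharp hT).1 hu
  let R : Submodule ℂ K := LinearMap.range T.toFun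
  have : CompleteSpace R := (_root_.IsClosed.isComplete (s := (R : Set K)) hR).completeSpace_coe
  obtain ⟨x, hx⟩ : R.starProjection y ∈ R := R.starProjection_apply_mem y
  have hx : T x = R.starProjection y := hx
  refine (mem_range_prodOp_sharp hT).2 ⟨x, fun w => ?_⟩
  rw [← h w, hx, eq_comm, ← sub_eq_zero, ← inner_sub_right, inner_eq_zero_symm]
  exact R.starProjection_inner_eq_zero y _ ⟨w, rfl⟩

/-- If `R(T♯ T) = R(T♯)` then `D(T♯) ⊆ R(T) + N(T♯)`. Hence the vectors `y` of `N(T♯)ᗮ` with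
`‖T♯ y‖ ≤ 1` are pointwise bounded as functionals on the graph of `T♯`, and the uniform boundedness
principle bounds `‖y‖ ^ 2` by a multiple of `‖y‖ + 1`. -/
theorem exists_sharp_bound_of_range_eq [CompleteSpace H] [CompleteSpace K]
    (hT : Dense (T.domain : Set H))
    (hR : Set.range (prodOp (ρ := RingHom.id ℂ) (T.sharp hT) T) = Set.range (T.sharp hT)) :
    ∃ M, ∀ y : (T.sharp hT).domain, ∃ y' : (T.sharp hT).domain,
      T.sharp hT y' = T.sharp hT y ∧ ‖(y' : K)‖ ≤ M * ‖T.sharp hT y‖ := by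
  let A := T.sharp hT
  -- `N` is the kernel of `T♯`.
  let N : Submodule ℂ K := (LinearMap.range T.toFun)ᗮ
  have hN : ∀ z : K, z ∈ N ↔ T.IsSharpPair z 0 := fun z => by
    rw [Submodule.mem_orthogonal]
    constructor
    · intro h x
      rw [inner_zero_left]
      exact h _ ⟨x, rfl⟩
    · rintro h _ ⟨x, rfl⟩
      exact (h x).trans (inner_zero_left _)
  have : CompleteSpace A.realGraph :=
    (_root_.IsClosed.isComplete (isClosedAntilinear_sharp hT).isClosed_realGraph).completeSpace_coe
  let B := {y : A.domain // (y : K) ∈ Nᗮ ∧ ‖A y‖ ≤ 1}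
  let F : B → A.realGraph →L[ℝ] ℂ := fun y =>
    ((innerSL ℂ (y.1 : K)).restrictScalars ℝ).comp
      ((ContinuousLinearMap.fst ℝ K H).comp A.realGraph.subtypeL)
  have hF : ∀ p : A.realGraph, ∃ C, ∀ y : B, ‖F y p‖ ≤ C := by
    rintro ⟨⟨a, b⟩, z, hz, hb⟩
    obtain rfl : (z : K) = a := hz
    obtain ⟨x, hx⟩ := (mem_range_prodOp_sharp hT).1 (hR.symm ▸ Set.mem_range_self z)
    have hzN : (z : K) - T x ∈ N := by
      rw [hN]
      simpa using (isSharpPair_sharp hT z).sub hx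
    refine ⟨‖(x : H)‖, fun ⟨y, hy, hy1⟩ => ?_⟩
    have h : ⟪(y : K), (z : K)⟫_ℂ = ⟪(y : K), T x⟫_ℂ := by
      rw [← sub_eq_zero, ← inner_sub_right]
      exact (Submodule.mem_orthogonal' _ _).1 hy _ hzN
    calc ‖⟪(y : K), (z : K)⟫_ℂ‖ = ‖⟪T x, (y : K)⟫_ℂ‖ := by rw [h, norm_inner_symm]
      _ = ‖⟪A y, (x : H)⟫_ℂ‖ := by rw [T.inner_sharp hT y x]
      _ ≤ ‖A y‖ * ‖(x : H)‖ := norm_inner_le_norm _ _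
      _ ≤ ‖(x : H)‖ := mul_le_of_le_one_left (norm_nonneg _) hy1
  obtain ⟨C, hC⟩ := banach_steinhaus hF
  have hB : ∀ y : A.domain, (y : K) ∈ Nᗮ → ‖A y‖ ≤ 1 → ‖(y : K)‖ ≤ C + 1 := fun y hy hy1 => by
    have h := (F ⟨y, hy, hy1⟩).le_of_opNorm_le (hC _) ⟨((y : K), A y), y, rfl, rfl⟩
    have h1 : ‖⟪(y : K), (y : K)⟫_ℂ‖ ≤ C * max ‖(y : K)‖ ‖A y‖ := h
    have hC0 : 0 ≤ C := (norm_nonneg _).trans (hC ⟨y, hy, hy1⟩)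
    rw [inner_self_eq_norm_sq_to_K] at h1
    have h2 : ‖(y : K)‖ ^ 2 ≤ C * max ‖(y : K)‖ ‖A y‖ := by simpa using h1
    by_contra! hlt
    rw [max_eq_left (by linarith)] at h2
    nlinarith
  refine ⟨C + 1, fun y => ?_⟩
  -- Replace `y` by its component in `N(T♯)ᗮ`, then rescale.
  have hP : T.IsSharpPair (N.starProjection y) 0 := (hN _).1 (N.starProjection_apply_mem _)
  obtain ⟨y', hy', hAy'⟩ := ((isSharpPair_sharp hT y).sub hP).exists_sharp_eq hT
  rw [sub_zero] at hAy'
  refine ⟨y', hAy', ?_⟩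
  have hperp : (y' : K) ∈ Nᗮ := by
    rw [hy']
    exact N.sub_starProjection_mem_orthogonal _
  rw [← hAy']
  rcases eq_or_ne (A y') 0 with h0 | h0
  · have hyN : (y' : K) ∈ N := (hN _).2 (h0 ▸ isSharpPair_sharp hT y')
    have : (y' : K) = 0 := inner_self_eq_zero.1 ((Submodule.mem_orthogonal _ _).1 hperp _ hyN)
    rw [this, show T.sharp hT y' = 0 from h0]
    simp
  · have hpos : 0 < ‖A y'‖ := norm_pos_iff.2 h0
    have h := hB (((‖A y'‖⁻¹ : ℝ) : ℂ) • y') (Nᗮ.smul_mem _ hperp)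
      (by rw [A.map_smulₛₗ, norm_smul]; simp [hpos.ne'])
    rw [Submodule.coe_smul, norm_smul, Complex.norm_real, norm_inv, norm_norm,
      inv_mul_le_iff₀ hpos] at h
    rwa [mul_comm] at h

/-- The kernel of `T` contains the orthogonal complement of `R(T♯ T)`: as `I + T♯ T` is onto, such a
vector is `x + T♯ T x`, and its orthogonality to `T♯ T x` reads `‖T x‖ ^ 2 + ‖T♯ T x‖ ^ 2 = 0`. -/
theorem exists_map_eq_zero_of_orthogonal_prodOp [CompleteSpace H] [CompleteSpace K]
    (hc : T.IsClosedAntilinear) {v : H}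
    (hv : ∀ (x : T.domain) (u : H), T.IsSharpPair (T x) u → ⟪u, v⟫_ℂ = 0) :
    ∃ x : T.domain, (x : H) = v ∧ T x = 0 := by
  obtain ⟨x, z, u, hzu, rfl, hz⟩ := exists_add_sharp_decomposition hc v 0
  obtain rfl : z = -T x := (neg_eq_of_add_eq_zero_right hz.symm).symm
  have hu : T.IsSharpPair (T x) (-u) := fun w => by
    rw [inner_neg_left, ← hzu w, inner_neg_right, neg_neg]
  have h := hv x _ hu
  rw [sub_eq_add_neg, inner_add_right, ← hu x] at h
  obtain ⟨h1, h2⟩ := eq_zero_of_inner_self_add_inner_self h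
  exact ⟨x, by rw [sub_eq_add_neg, h2, add_zero], h1⟩

theorem range_prodOp_sharp_eq_of_isClosed [CompleteSpace H] [CompleteSpace K]
    (hT : Dense (T.domain : Set H)) (hc : T.IsClosedAntilinear)
    (hR : _root_.IsClosed (Set.range (prodOp (ρ := RingHom.id ℂ) (T.sharp hT) T))) :
    Set.range (prodOp (ρ := RingHom.id ℂ) (T.sharp hT) T) = Set.range (T.sharp hT) := by
  refine (range_prodOp_sharp_subset hT).antisymm fun u hu => ?_
  let R : Submodule ℂ H := LinearMap.range (prodOp (ρ := RingHom.id ℂ) (T.sharp hT) T).toFun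
  have : CompleteSpace R := (_root_.IsClosed.isComplete (s := (R : Set H)) hR).completeSpace_coe
  obtain ⟨y, h⟩ := (mem_range_sharp hT).1 hu
  suffices hmem : u ∈ Rᗮᗮ by
    rw [Submodule.orthogonal_orthogonal] at hmem
    exact hmem
  rw [Submodule.mem_orthogonal']
  intro v hv
  obtain ⟨x, rfl, hx⟩ := exists_map_eq_zero_of_orthogonal_prodOp hc (v := v) fun x w hw =>
    (Submodule.mem_orthogonal _ _).1 hv w ((mem_range_prodOp_sharp hT).2 ⟨x, hw⟩)
  rw [← h x, hx, inner_zero_left]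

theorem tfae_isClosed_range [CompleteSpace H] [CompleteSpace K]
    (hT : Dense (T.domain : Set H)) (hc : T.IsClosedAntilinear) :
    List.TFAE [
      _root_.IsClosed (Set.range (T.sharp hT)),
      Set.range (prodOp (ρ := RingHom.id ℂ) (T.sharp hT) T) = Set.range (T.sharp hT),
      _root_.IsClosed (Set.range (prodOp (ρ := RingHom.id ℂ) (T.sharp hT) T)),
      _root_.IsClosed (Set.range T)] := by
  tfae_have 4 ↔ 1 := isClosed_range_iff_sharp hT hc
  tfae_have 4 → 2 := range_prodOp_sharp_eq_of_isClosed_range hT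
  tfae_have 2 → 4 := fun h =>
    have ⟨_, hM⟩ := exists_sharp_bound_of_range_eq hT h
    isClosed_range_of_sharp_bound hT hc hM
  tfae_have 3 → 2 := range_prodOp_sharp_eq_of_isClosed hT hc
  tfae_have 4 → 3 := fun h => by
    rw [range_prodOp_sharp_eq_of_isClosed_range hT h]
    exact (isClosed_range_iff_sharp hT hc).1 h
  tfae_finish

end LinearPMap

/-! ### Conjugations -/

theorem IsConjugation.continuous {K : Type*} [NormedAddCommGroup K] [InnerProductSpace ℂ K]
    {C : K →ₛₗ[starRingEnd ℂ] K} (hC : IsConjugation C) : Continuous C := by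
  refine AddMonoidHomClass.continuous_of_bound C 1 fun x => ?_
  rw [one_mul, @norm_eq_sqrt_re_inner ℂ, @norm_eq_sqrt_re_inner ℂ _ _ _ _ x, hC.inner_map_map]

theorem isClosedAntilinear_conjComp {H K : Type*} [NormedAddCommGroup H] [InnerProductSpace ℂ H]
    [NormedAddCommGroup K] [InnerProductSpace ℂ K]
    {C : K →ₛₗ[starRingEnd ℂ] K} (hC : IsConjugation C) {S : H →ₗ.[ℂ] K} (hS : S.IsClosed) :
    (conjComp C S).IsClosedAntilinear := by
  -- The graph of `C S` is the preimage of the graph of `S` under `(x, y) ↦ (x, C y)`.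
  have h : {p : H × K | ∃ x : (conjComp C S).domain, (x : H) = p.1 ∧ conjComp C S x = p.2} =
      (fun p : H × K => (p.1, C p.2)) ⁻¹' (S.graph : Set (H × K)) := by
    ext ⟨a, b⟩
    simp only [Set.mem_ofPred_eq, Set.mem_preimage, SetLike.mem_coe, LinearPMap.mem_graph_iff]
    constructor
    · rintro ⟨x, hx, rfl⟩
      exact ⟨x, hx, (hC.involutive (S x)).symm⟩
    · rintro ⟨x, hx, hb⟩
      refine ⟨x, hx, ?_⟩
      change C (S x) = b
      rw [hb, hC.involutive]
  rw [LinearPMap.IsClosedAntilinear, h]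
  exact IsClosed.preimage (continuous_fst.prodMk (hC.continuous.comp continuous_snd)) hS

end

theorem theorem7 {H K : Type*}
    [NormedAddCommGroup H] [InnerProductSpace ℂ H] [CompleteSpace H]
    [NormedAddCommGroup K] [InnerProductSpace ℂ K] [CompleteSpace K] :
    (∀ (S : H →ₗ.[ℂ] K) (hS : Dense (S.domain : Set H)) (_ : S.IsClosed)
        (C : K →ₛₗ[starRingEnd ℂ] K) (_ : IsConjugation C),
      List.TFAE [
        IsClosed (Set.range ((conjComp C S).sharp (dense_domain_conjComp C hS))),
        Set.range (LinearPMap.prodOp (ρ := RingHom.id ℂ)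
            ((conjComp C S).sharp (dense_domain_conjComp C hS)) (conjComp C S)) =
          Set.range ((conjComp C S).sharp (dense_domain_conjComp C hS)),
        IsClosed (Set.range (LinearPMap.prodOp (ρ := RingHom.id ℂ)
            ((conjComp C S).sharp (dense_domain_conjComp C hS)) (conjComp C S))),
        IsClosed (Set.range (conjComp C S))]) ∧
    (∀ (T : H →ₛₗ.[starRingEnd ℂ] K) (hT : Dense (T.domain : Set H)) (_ : T.IsClosedAntilinear),
      IsClosed (Set.range T) ↔ IsClosed (Set.range (T.sharp hT))) := by
  exact ⟨fun S hS hc C hC => LinearPMap.tfae_isClosed_range (dense_domain_conjComp C hS)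
    (isClosedAntilinear_conjComp hC hc), fun T hT hc => LinearPMap.isClosed_range_iff_sharp hT hc⟩
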